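/- A \emph{generalized partition with $n$ parts} is a sequence $\lambda=(\lambda_1\ge\dots\ge\lambda_n)$ of integers; adding (deleting) a box in row $i$ means adding $1$ to (subtracting $1$ from) $\lambda_i$. A \emph{generalized oscillating tableau} in $\mathrm{GOT}(k,n)$ is a sequence $T=(\lambda^0,\dots,\lambda^k)$ of generalized partitions with $n$ parts with $\lambda^0=(0,\dots,0)$ such that each $\lambda^{s}$ is obtained from $\lambda^{s-1}$ by adding or deleting one box. \emph{Promotion.} For $T\in\mathrm{GOT}(k,n)$, the promotion $p(T)=(\mu^0,\dots,\mu^k)\in\mathrm{GOT}(k,n)$ is the unique tableau with $\mu^0=(0,\dots,0)$, $\mu^k=\lambda^k$ and, for $1\le s<k$: if $\lambda^s$ is obtained from $\mu^{s-1}$ by adding a box in row $i$ and $\lambda^{s+1}$ from $\lambda^s$ by adding or deleting a box in row $j$, then $\mu^s$ is obtained from $\mu^{s-1}$ by that same second action whenever the result is a generalized partition; otherwise, if the second action is an addition (then $j\ne i$), $\mu^s$ is $\mu^{s-1}$ with a box added in row $i$, and if it is a deletion (then $j=i$), $\mu^s$ is $\mu^{s-1}$ with a box deleted in row $i+t$,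 where $t>0$ is the least value for which this is a generalized partition. If $\lambda^s$ is obtained from $\mu^{s-1}$ by deleting a box in row $i$, the rules are the same with adding and deleting exchanged and $i-t$ in place of $i+t$. \emph{Webs.} A \emph{web} (irreducible $A_2$-web) is a planar bipartite graph without multiple edges, with vertices coloured black ($\bullet$) and white ($\circ$), embedded in a disk, whose boundary vertices have degree $1$, whose internal vertices have degree $3$, and all of whose internal faces have at least $6$ sides, considered up to homeomorphism. It \emph{contains the identity web} if some edge joins two boundary vertices. Let $D$ be a web with boundary vertices $v_1,\dots,v_k$ in clockwise order from a chosen leftmost vertex $v_1$. Its \emph{signature and state string} is the dominant string $((j_1,c_1),\dots,(j_k,c_k))$, $j_s\in\{1,0,\bar1\}$, $c_s\in\{\bullet,\circ\}$ the colour of $v_s$, from which the Khovanov--Kuperberg growth rules build $D$: hang from $v_1,\dots,v_k$, placed on a line, strands labelled $j_1,\dots,j_k$, and repeatedly replace two neighbouring strands (the colour of a strand is that of its upper end) until none is left, by \begin{itemize} \item joining them at a new vertex of the opposite colour with one new strand: $1_\bullet0_\bullet\to\bar1_\circ$, $0_\bullet\bar1_\bullet\to1_\circ$, $1_\bullet\bar1_\bullet\to0_\circ$,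 $\bar1_\circ0_\circ\to1_\bullet$, $0_\circ1_\circ\to\bar1_\bullet$, $\bar1_\circ1_\circ\to0_\bullet$; \item ending them at two new vertices joined by an edge, each with one new strand: $1_\bullet0_\circ\to0_\circ1_\bullet$, $0_\bullet0_\circ\to1_\circ1_\bullet$, $0_\bullet1_\circ\to1_\circ0_\bullet$, $\bar1_\circ0_\bullet\to0_\bullet\bar1_\circ$, $0_\circ0_\bullet\to\bar1_\bullet\bar1_\circ$, $0_\circ\bar1_\bullet\to\bar1_\bullet0_\circ$; \item joining them to one edge: $1_\bullet1_\circ$ or $\bar1_\circ\bar1_\bullet$. \end{itemize} Here a string is \emph{dominant} if the path of partial sums of its weights, where $(1,\bullet),(0,\bullet),(\bar1,\bullet)$ have the three weights of the vector representation of $\mathfrak{sl}(3)$ and $(j,\circ)$ has the negative of the weight of $(j,\bullet)$, stays in the dominant chamber (the non-negative integral combinations of the weights of $(1,\bullet)$ and $(\bar1,\circ)$) and ends at the origin. The tableau $T=(\lambda^0,\dots,\lambda^k)\in\mathrm{GOT}(k,3)$ that \emph{comes from} $D$ has $\lambda^s$ obtained from $\lambda^{s-1}$ by adding (if $c_s=\bullet$)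 or deleting (if $c_s=\circ$) a box in row $1$, $2$, $3$ according as $j_s=1,0,\bar1$. \textbf{Proposition.} Let $T=(\lambda^0,\dots,\lambda^k)$ come from a web that does not contain the identity web, and let $p(T)=(\mu^0,\dots,\mu^k)$. \begin{enumerate} \item If $\lambda^1=(1,0,0)$, then for every $s\in[1,k]$ the shape $\lambda^s$ is obtained from $\mu^{s-1}$ by adding a box in some row $i_s$, and there are $m,n\in[1,k]$ with $m+1<n$ such that $i_s=1$ for $s\le m$, $i_s=2$ for $m<s<n$, and $i_s=3$ for $s\ge n$. \item If $\lambda^1=(0,0,-1)$, then for every $s\in[1,k]$ the shape $\lambda^s$ is obtained from $\mu^{s-1}$ by deleting a box in some row $i_s$, and there are $m,n\in[1,k]$ with $m+1<n$ such that $i_s=3$ for $s\le m$, $i_s=2$ for $m<s<n$, and $i_s=1$ for $s\ge n$. \end{enumerate} -/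

import Mathlib

/-! ### Generalized oscillating tableaux -/

/-- Add one box in row `i` of a sequence of `n` integer row sizes. -/
def addBox {n : ℕ} (a : Fin n → ℤ) (i : Fin n) : Fin n → ℤ := a + Pi.single i 1

/-- Delete one box in row `i` of a sequence of `n` integer row sizes. -/
def delBox {n : ℕ} (a : Fin n → ℤ) (i : Fin n) : Fin n → ℤ := a - Pi.single i 1

/-- `b` is obtained from `a` by adding or deleting one box. -/
def OneBox {n : ℕ} (a b : Fin n → ℤ) : Prop := ∃ i, b = addBox a i ∨ b = delBox a i

/-- Generalized oscillating tableaux of length `k` with `n` parts: a generalized partition with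
`n` parts is an antitone function `Fin n → ℤ` (row `i` of the usual numbering is `i - 1`). -/
@[ext]
structure GOT (k n : ℕ) where
  shape : Fin (k + 1) → Fin n → ℤ
  isGenPartition : ∀ s, Antitone (shape s)
  shape_zero : shape 0 = 0
  oneBox : ∀ s : Fin k, OneBox (shape s.castSucc) (shape s.succ)

/-! ### Generalized oscillating promotion -/

/-- The local growth rules: `GrowthRule mu lam lam' nu` says that `nu` (playing `μ^s`) is the shape
that the rules produce from `mu` (`μ^{s-1}`), `lam` (`λ^s`) and `lam'` (`λ^{s+1}`). -/
inductive GrowthRule {n : ℕ} (mu lam lam' : Fin n → ℤ) : (Fin n → ℤ) → Prop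
  | op1a (i j : Fin n) (h1 : lam = addBox mu i) (h2 : lam' = addBox lam j)
      (h : Antitone (addBox mu j)) : GrowthRule mu lam lam' (addBox mu j)
  | op1b (i j : Fin n) (h1 : lam = addBox mu i) (h2 : lam' = addBox lam j) (hij : j ≠ i)
      (h : ¬ Antitone (addBox mu j)) : GrowthRule mu lam lam' (addBox mu i)
  | op1c (i j : Fin n) (h1 : lam = addBox mu i) (h2 : lam' = delBox lam j)
      (h : Antitone (delBox mu j)) : GrowthRule mu lam lam' (delBox mu j)
  | op1d (i r : Fin n) (h1 : lam = addBox mu i) (h2 : lam' = delBox lam i)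
      (h : ¬ Antitone (delBox mu i)) (hr : i < r) (hr' : Antitone (delBox mu r))
      (hmin : ∀ q, i < q → q < r → ¬ Antitone (delBox mu q)) :
      GrowthRule mu lam lam' (delBox mu r)
  | op2a (i j : Fin n) (h1 : lam = delBox mu i) (h2 : lam' = delBox lam j)
      (h : Antitone (delBox mu j)) : GrowthRule mu lam lam' (delBox mu j)
  | op2b (i j : Fin n) (h1 : lam = delBox mu i) (h2 : lam' = delBox lam j) (hij : j ≠ i)
      (h : ¬ Antitone (delBox mu j)) : GrowthRule mu lam lam' (delBox mu i)
  | op2c (i j : Fin n) (h1 : lam = delBox mu i) (h2 : lam' = addBox lam j)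
      (h : Antitone (addBox mu j)) : GrowthRule mu lam lam' (addBox mu j)
  | op2d (i r : Fin n) (h1 : lam = delBox mu i) (h2 : lam' = addBox lam i)
      (h : ¬ Antitone (addBox mu i)) (hr : r < i) (hr' : Antitone (addBox mu r))
      (hmin : ∀ q, r < q → q < i → ¬ Antitone (addBox mu q)) :
      GrowthRule mu lam lam' (addBox mu r)

/-- `P = (μ^0, …, μ^k)` is produced from `T = (λ^0, …, λ^k)` by the promotion growth rules. -/
structure IsPromotion {k n : ℕ} (T P : GOT k n) : Prop where
  rule : ∀ (s : ℕ) (hs : s + 2 ≤ k),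
    GrowthRule (P.shape ⟨s, by omega⟩) (T.shape ⟨s + 1, by omega⟩)
      (T.shape ⟨s + 2, by omega⟩) (P.shape ⟨s + 1, by omega⟩)
  last : P.shape (Fin.last k) = T.shape (Fin.last k)

theorem addBox_eq_iff {n : ℕ} {a : Fin n → ℤ} {i j : Fin n} : addBox a i = addBox a j ↔ i = j := by
  constructor
  · intro h
    by_contra hij
    have := congrFun h i
    simp [addBox, hij] at this
  · rintro rfl; rfl

theorem delBox_eq_iff {n : ℕ} {a : Fin n → ℤ} {i j : Fin n} : delBox a i = delBox a j ↔ i = j := by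
  constructor
  · intro h
    by_contra hij
    have := congrFun h i
    simp [delBox, hij] at this
  · rintro rfl; rfl

theorem addBox_ne_delBox {n : ℕ} (a : Fin n → ℤ) (i j : Fin n) : addBox a i ≠ delBox a j := by
  intro h
  have := congrFun h i
  simp only [addBox, delBox, Pi.add_apply, Pi.sub_apply, Pi.single_apply] at this
  split_ifs at this <;> omega

theorem antitone_addBox_iff {n : ℕ} {a : Fin n → ℤ} (ha : Antitone a) (j : Fin n) :
    Antitone (addBox a j) ↔ ∀ r < j, a j < a r := by
  constructor
  · intro h r hr
    have := h hr.le
    simp only [addBox, Pi.add_apply, Pi.single_apply, if_neg hr.ne] at this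
    simp at this
    omega
  · intro h x y hxy
    have h0 := ha hxy
    simp only [addBox, Pi.add_apply, Pi.single_apply]
    split_ifs with h1 h2 h2
    · omega
    · subst h1
      have := h x (lt_of_le_of_ne hxy h2)
      omega
    · omega
    · omega

theorem antitone_delBox_iff {n : ℕ} {a : Fin n → ℤ} (ha : Antitone a) (j : Fin n) :
    Antitone (delBox a j) ↔ ∀ r, j < r → a r < a j := by
  constructor
  · intro h r hr
    have := h hr.le
    simp only [delBox, Pi.sub_apply, Pi.single_apply, if_neg hr.ne'] at this
    simp at this
    omega
  · intro h x y hxy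
    have h0 := ha hxy
    simp only [delBox, Pi.sub_apply, Pi.single_apply]
    split_ifs with h1 h2 h2
    · omega
    · omega
    · subst h2
      have := h y (lt_of_le_of_ne hxy fun e => h1 e.symm)
      omega
    · omega

theorem addBox_delBox {n : ℕ} (a : Fin n → ℤ) (i j : Fin n) :
    addBox (delBox a i) j = delBox (addBox a j) i := by
  simp only [addBox, delBox]; abel

theorem addBox_addBox {n : ℕ} (a : Fin n → ℤ) (i j : Fin n) :
    addBox (addBox a i) j = addBox (addBox a j) i := by
  simp only [addBox]; abel

theorem delBox_delBox {n : ℕ} (a : Fin n → ℤ) (i j : Fin n) :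
    delBox (delBox a i) j = delBox (delBox a j) i := by
  simp only [delBox]; abel

theorem delBox_addBox_self {n : ℕ} (a : Fin n → ℤ) (i : Fin n) :
    delBox (addBox a i) i = a := by
  simp [addBox, delBox]

theorem GrowthRule.unique {n : ℕ} {mu lam lam' x y : Fin n → ℤ}
    (hx : GrowthRule mu lam lam' x) (hy : GrowthRule mu lam lam' y) : x = y := by
  cases hx <;> cases hy <;>
    grind [addBox_eq_iff, delBox_eq_iff, addBox_ne_delBox]

theorem GrowthRule.exists {n : ℕ} {mu lam lam' : Fin n → ℤ}
    (hmu : Antitone mu) (hlam : Antitone lam) (hlam' : Antitone lam')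
    (h1 : OneBox mu lam) (h2 : OneBox lam lam') :
    ∃ nu, GrowthRule mu lam lam' nu ∧ Antitone nu ∧ OneBox mu nu ∧ OneBox nu lam' := by
  obtain ⟨i, hi | hi⟩ := h1 <;> obtain ⟨j, hj | hj⟩ := h2
  · by_cases h : Antitone (addBox mu j)
    · exact ⟨_, .op1a i j hi hj h, h, ⟨j, .inl rfl⟩, i, .inl (by rw [hj, hi, addBox_addBox])⟩
    · refine ⟨_, .op1b i j hi hj ?_ h, hi ▸ hlam, ⟨i, .inl rfl⟩, j, .inl (by rw [hj, hi])⟩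
      rintro rfl
      exact h (hi ▸ hlam)
  · by_cases h : Antitone (delBox mu j)
    · exact ⟨_, .op1c i j hi hj h, h, ⟨j, .inr rfl⟩, i, .inl (by rw [hj, hi, addBox_delBox])⟩
    · have hji : j = i := by
        by_contra hji
        apply h
        rw [antitone_delBox_iff hmu]
        intro r hr
        have := hlam' hr.le
        rw [hj, hi] at this
        simp only [addBox, delBox, Pi.add_apply, Pi.sub_apply, Pi.single_apply, if_neg hr.ne',
          if_neg hji, if_true] at this
        split_ifs at this <;> omega
      subst hji
      have hne : {r : Fin n | j < r ∧ Antitone (delBox mu r)}.Nonempty := by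
        rw [antitone_delBox_iff hmu] at h
        push Not at h
        obtain ⟨r, hr, -⟩ := h
        refine ⟨⟨n - 1, by omega⟩, ?_, ?_⟩
        · rw [Fin.lt_def] at hr ⊢
          simp only
          omega
        · rw [antitone_delBox_iff hmu]
          intro q hq
          rw [Fin.lt_def] at hq
          simp only at hq
          omega
      obtain ⟨r, ⟨hr, hr'⟩, hmin⟩ := wellFounded_lt.has_min _ hne
      exact ⟨_, .op1d j r hi hj h hr hr' fun q hq hqr hq' => hmin q ⟨hq, hq'⟩ hqr, hr',
        ⟨r, .inr rfl⟩, r, .inl (by rw [hj, hi, delBox_addBox_self, addBox_delBox,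
          delBox_addBox_self])⟩
  · by_cases h : Antitone (addBox mu j)
    · exact ⟨_, .op2c i j hi hj h, h, ⟨j, .inl rfl⟩, i, .inr (by rw [hj, hi, addBox_delBox])⟩
    · have hji : j = i := by
        by_contra hji
        apply h
        rw [antitone_addBox_iff hmu]
        intro r hr
        have := hlam' hr.le
        rw [hj, hi] at this
        simp only [addBox, delBox, Pi.add_apply, Pi.sub_apply, Pi.single_apply, if_neg hr.ne,
          if_neg hji, if_true] at this
        split_ifs at this <;> omega
      subst hji
      have hne : {r : Fin n | r < j ∧ Antitone (addBox mu r)}.Nonempty := by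
        rw [antitone_addBox_iff hmu] at h
        push Not at h
        obtain ⟨r, hr, -⟩ := h
        refine ⟨⟨0, by omega⟩, ?_, ?_⟩
        · rw [Fin.lt_def] at hr ⊢
          simp only
          omega
        · rw [antitone_addBox_iff hmu]
          intro q hq
          rw [Fin.lt_def] at hq
          simp only at hq
          omega
      obtain ⟨r, ⟨hr, hr'⟩, hmin⟩ := wellFounded_gt.has_min _ hne
      exact ⟨_, .op2d j r hi hj h hr hr' fun q hq hqr hq' => hmin q ⟨hqr, hq'⟩ hq, hr',
        ⟨r, .inl rfl⟩, r, .inr (by rw [hj, hi, addBox_delBox, delBox_addBox_self,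
          delBox_addBox_self])⟩
  · by_cases h : Antitone (delBox mu j)
    · exact ⟨_, .op2a i j hi hj h, h, ⟨j, .inr rfl⟩, i, .inr (by rw [hj, hi, delBox_delBox])⟩
    · refine ⟨_, .op2b i j hi hj ?_ h, hi ▸ hlam, ⟨i, .inr rfl⟩, j, .inr (by rw [hj, hi])⟩
      rintro rfl
      exact h (hi ▸ hlam)

open Classical in
theorem GOT.exists_isPromotion {k n : ℕ} (T : GOT k n) : ∃ P : GOT k n, IsPromotion T P := by
  let L : ℕ → Fin n → ℤ := fun s => if h : s ≤ k then T.shape ⟨s, by omega⟩ else 0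
  have hL : ∀ s (h : s ≤ k), L s = T.shape ⟨s, by omega⟩ := fun s h => dif_pos h
  have hLstep : ∀ s, s < k → OneBox (L s) (L (s + 1)) := by
    intro s h
    rw [hL s h.le, hL (s + 1) h]
    exact T.oneBox ⟨s, h⟩
  have hLanti : ∀ s, s ≤ k → Antitone (L s) := fun s h => hL s h ▸ T.isGenPartition _
  have hL0 : L 0 = 0 := (hL 0 (by omega)).trans T.shape_zero
  let Q : ℕ → (Fin n → ℤ) → (Fin n → ℤ) → Prop := fun s x nu =>
    GrowthRule x (L (s + 1)) (L (s + 2)) nu ∧ Antitone nu ∧ OneBox x nu ∧ OneBox nu (L (s + 2))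
  let step : ℕ → (Fin n → ℤ) → Fin n → ℤ := fun s x => if h : ∃ nu, Q s x nu then h.choose else x
  let M : ℕ → Fin n → ℤ := fun s => Nat.rec 0 step s
  have hMQ : ∀ s, (∃ nu, Q s (M s) nu) → Q s (M s) (M (s + 1)) := by
    intro s h
    have : M (s + 1) = h.choose := dif_pos h
    rw [this]
    exact h.choose_spec
  have hM : ∀ s, s < k → Antitone (M s) ∧ OneBox (M s) (L (s + 1)) := by
    intro s
    induction s with
    | zero =>
      intro h
      refine ⟨fun _ _ _ => le_rfl, ?_⟩
      have := hLstep 0 h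
      rwa [hL0] at this
    | succ s ih =>
      intro h
      obtain ⟨h1, h2⟩ := ih (by omega)
      have := hMQ s (GrowthRule.exists h1 (hLanti _ (by omega)) (hLanti _ (by omega)) h2
        (hLstep (s + 1) h))
      exact ⟨this.2.1, this.2.2.2⟩
  have hMrule : ∀ s, s + 1 < k → Q s (M s) (M (s + 1)) := fun s h =>
    hMQ s (GrowthRule.exists (hM s (by omega)).1 (hLanti _ (by omega)) (hLanti _ (by omega))
      (hM s (by omega)).2 (hLstep (s + 1) h))
  let R : ℕ → Fin n → ℤ := fun s => if s < k then M s else L k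
  have hR1 : ∀ s, s < k → R s = M s := fun s h => if_pos h
  have hR2 : R k = L k := if_neg (lt_irrefl k)
  refine ⟨⟨fun s => R s, ?_, ?_, ?_⟩, ?_, ?_⟩
  · intro s
    show Antitone (R s)
    by_cases h : (s : ℕ) < k
    · rw [hR1 _ h]; exact (hM _ h).1
    · rw [show (s : ℕ) = k by omega, hR2]; exact hLanti k le_rfl
  · show R 0 = 0
    by_cases h : 0 < k
    · exact hR1 _ h
    · rw [show 0 = k by omega, hR2, ← show 0 = k by omega, hL0]
  · intro s
    show OneBox (R s) (R (s + 1))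
    rw [hR1 _ s.2]
    by_cases h : (s : ℕ) + 1 < k
    · rw [hR1 _ h]; exact (hMrule _ h).2.2.1
    · have hs : (s : ℕ) + 1 = k := by omega
      have := (hM _ s.2).2
      rw [hs] at this ⊢
      rwa [hR2]
  · intro s hs
    show GrowthRule (R s) _ _ (R (s + 1))
    by_cases h : s + 1 < k
    · rw [hR1 _ h, hR1 _ (by omega), ← hL, ← hL]
      · exact (hMrule _ h).1
      · omega
      · omega
    · omega
  · show R k = _
    rw [hR2, hL k le_rfl]
    rfl

theorem GOT.existsUnique_isPromotion {k n : ℕ} (T : GOT k n) : ∃! P : GOT k n, IsPromotion T P := by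
  obtain ⟨P, hP⟩ := T.exists_isPromotion
  refine ⟨P, hP, fun P' hP' => ?_⟩
  have key : ∀ s (h : s < k), P'.shape ⟨s, by omega⟩ = P.shape ⟨s, by omega⟩ := by
    intro s
    induction s with
    | zero => intro h; exact P'.shape_zero.trans P.shape_zero.symm
    | succ s ih =>
      intro h
      have h1 := hP'.rule s (by omega)
      rw [ih (by omega)] at h1
      exact h1.unique (hP.rule s (by omega))
  apply GOT.ext
  funext s
  by_cases h : (s : ℕ) < k
  · exact key s h
  · have : s = Fin.last k := Fin.ext (by simp; omega)
    rw [this, hP'.last, hP.last]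

/-- Generalized oscillating promotion `p : GOT(k, n) → GOT(k, n)`. -/
noncomputable def GOT.promotion {k n : ℕ} (T : GOT k n) : GOT k n :=
  T.existsUnique_isPromotion.choose

/-! ### Webs -/

/-- Colours of vertices. -/
inductive Color
  | black
  | white

/-- The states `1`, `0` and `-1`. -/
inductive State
  | one
  | zero
  | negOne

/-- Half-edges of a graph in a disk whose boundary vertices `0, …, k - 1` have degree one and whose
internal vertices `v : V` have degree three. The half-edges at `v` are `(v, 0), (v, 1), (v, 2)` in
clockwise cyclic order. -/
abbrev Dart (k : ℕ) (V : Type*) := Fin k ⊕ V × Fin 3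

/-- The vertex of a half-edge. -/
def Dart.vertex {k : ℕ} {V : Type*} : Dart k V → Fin k ⊕ V
  | Sum.inl i => Sum.inl i
  | Sum.inr x => Sum.inr x.1

/-- The clockwise successor of a half-edge. The exterior of the disk is regarded as one
vertex of the sphere that carries the `k` boundary half-edges; the clockwise order of the boundary
vertices seen from inside the disk is counterclockwise seen from outside. -/
def Dart.next (k : ℕ) (V : Type*) : Equiv.Perm (Dart k V) :=
  Equiv.sumCongr (finRotate k).symm (Equiv.prodCongr (Equiv.refl V) (Equiv.addRight 1))

/-- The number of cycles of a permutation, fixed points included. -/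
noncomputable def numCycles {X : Type*} (p : Equiv.Perm X) : ℕ :=
  Nat.card (Quotient (Equiv.Perm.SameCycle.setoid p))

/-- Irreducible (non-elliptic) `A_2`-webs in a disk with `k` boundary vertices, given as
combinatorial maps. The boundary vertices are numbered clockwise from the chosen leftmost vertex
`0`, and `V` is the set of internal vertices. -/
structure Web (k : ℕ) (V : Type*) [Finite V] where
  color : Fin k ⊕ V → Color
  /-- exchanges the two halves of each edge -/
  edge : Equiv.Perm (Dart k V)
  edge_edge : ∀ d, edge (edge d) = d
  bipartite : ∀ d, color (edge d).vertex ≠ color d.vertex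
  no_multiple_edges : ∀ d d', d.vertex = d'.vertex → (edge d).vertex = (edge d').vertex → d = d'
  /-- Euler's formula `V - E + F = 2 C`: the map has genus zero. -/
  planar : numCycles (Dart.next k V) + numCycles (Dart.next k V * edge) =
    numCycles edge +
      2 * Nat.card (MulAction.orbitRel.Quotient (Subgroup.closure {Dart.next k V, edge}) (Dart k V))
  /-- Faces are the cycles of `next ∘ edge`; those that do not meet the boundary of the disk have
  at least six sides. -/
  nonelliptic : ∀ d, (∀ i, ¬ (Dart.next k V * edge).SameCycle d (Sum.inl i)) →
    6 ≤ Nat.card {d' // (Dart.next k V * edge).SameCycle d d'}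

/-- `D` contains the identity web (an edge joining two boundary vertices) as a component. -/
def Web.ContainsIdentity {k : ℕ} {V : Type*} [Finite V] (D : Web k V) : Prop :=
  ∃ i j : Fin k, D.edge (Sum.inl i) = Sum.inl j

/-! ### Signature and state strings and the web growth rules -/

/-- The Y-shaped growth rules: two neighbouring strands of the given colour with the first two
states are joined to a strand of the other colour with the third state. -/
inductive YRule : Color → State → State → State → Prop
  | b1 : YRule .black .one .zero .negOne
  | b2 : YRule .black .zero .negOne .one
  | b3 : YRule .black .one .negOne .zero
  | w1 : YRule .white .negOne .zero .one
  | w2 : YRule .white .zero .one .negOne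
  | w3 : YRule .white .negOne .one .zero

/-- The H-shaped growth rules: a strand of the given colour and its right neighbour, of the other
colour, with the first two states, are replaced by two strands with the last two states. -/
inductive HRule : Color → State → State → State → State → Prop
  | b1 : HRule .black .one .zero .zero .one
  | b2 : HRule .black .zero .zero .one .one
  | b3 : HRule .black .zero .one .one .zero
  | w1 : HRule .white .negOne .zero .zero .negOne
  | w2 : HRule .white .zero .zero .negOne .negOne
  | w3 : HRule .white .zero .negOne .negOne .zero

/-- The arc growth rules: a strand of the given colour and its right neighbour, of the other
colour, both with the given state, are joined. -/
inductive ArcRule : Color → State → Prop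
  | b : ArcRule .black .one
  | w : ArcRule .white .negOne

/-- `D.Grows l U`: starting from the strands `l` (from left to right; a strand is
an edge hanging down from the vertex of its half-edge, labelled by a state), the
growth rules can be applied until no strand is left, and what they draw is the part of `D` below
the strands, whose set of internal vertices is `U`. -/
inductive Web.Grows {k : ℕ} {V : Type*} [Finite V] (D : Web k V) :
    List (Dart k V × State) → Set V → Prop
  | done : Web.Grows D [] ∅
  /-- The new vertex `v` has the half-edges `(v, a)` up left, `(v, a + 1)` up right and
  `(v, a + 2)` down. -/
  | fork (l r : List (Dart k V × State)) (U : Set V) (d₁ d₂ : Dart k V) (s₁ s₂ t : State)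
      (v : V) (a : Fin 3)
      (hc : D.color d₂.vertex = D.color d₁.vertex)
      (hrule : YRule (D.color d₁.vertex) s₁ s₂ t)
      (h₁ : D.edge d₁ = Sum.inr (v, a)) (h₂ : D.edge d₂ = Sum.inr (v, a + 1))
      (hv : v ∉ U)
      (h : Web.Grows D (l ++ (Sum.inr (v, a + 2), t) :: r) U) :
      Web.Grows D (l ++ (d₁, s₁) :: (d₂, s₂) :: r) (insert v U)
  /-- The new left vertex `v` has the half-edges `(v, a)` up left, `(v, a + 1)` right and
  `(v, a + 2)` down left; the new right vertex `w` has the half-edges `(w, b)` up right,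
  `(w, b + 1)` down right and `(w, b + 2)` left. -/
  | cross (l r : List (Dart k V × State)) (U : Set V) (d₁ d₂ : Dart k V) (s₁ s₂ t₁ t₂ : State)
      (v w : V) (a b : Fin 3)
      (hc : D.color d₂.vertex ≠ D.color d₁.vertex)
      (hrule : HRule (D.color d₁.vertex) s₁ s₂ t₁ t₂)
      (h₁ : D.edge d₁ = Sum.inr (v, a)) (h₂ : D.edge d₂ = Sum.inr (w, b))
      (hmid : D.edge (Sum.inr (v, a + 1)) = Sum.inr (w, b + 2))
      (hvw : v ≠ w) (hv : v ∉ U) (hw : w ∉ U)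
      (h : Web.Grows D (l ++ (Sum.inr (v, a + 2), t₁) :: (Sum.inr (w, b + 1), t₂) :: r) U) :
      Web.Grows D (l ++ (d₁, s₁) :: (d₂, s₂) :: r) (insert v (insert w U))
  | arc (l r : List (Dart k V × State)) (U : Set V) (d₁ d₂ : Dart k V) (s : State)
      (hc : D.color d₂.vertex ≠ D.color d₁.vertex)
      (hrule : ArcRule (D.color d₁.vertex) s)
      (h₁ : D.edge d₁ = d₂)
      (h : Web.Grows D (l ++ r) U) :
      Web.Grows D (l ++ (d₁, s) :: (d₂, s) :: r) U

/-- The `sl(3)`-weight of a state with a black vertex, in the basis of the weight lattice formed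
by the weights of `(1, •)` and `(-1, ∘)`. -/
def State.weight : State → ℤ × ℤ
  | .one => (1, 0)
  | .zero => (-1, 1)
  | .negOne => (0, -1)

/-- The weight of a state and colour. -/
def letterWeight : State → Color → ℤ × ℤ
  | s, .black => s.weight
  | s, .white => -s.weight

/-- The signature and state string with states `s` and colours `c` is dominant: its weight path
starts and ends at the origin and stays in the dominant chamber. -/
def IsDominant {k : ℕ} (s : Fin k → State) (c : Fin k → Color) : Prop :=
  ∃ path : Fin (k + 1) → ℤ × ℤ, path 0 = 0 ∧ path (Fin.last k) = 0 ∧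
    (∀ i : Fin k, path i.succ = path i.castSucc + letterWeight (s i) (c i)) ∧ ∀ i, 0 ≤ path i

/-- The row on which a state acts. -/
def State.row : State → Fin 3
  | .one => 0
  | .zero => 1
  | .negOne => 2

/-- The action of a letter of a signature and state string on a generalized partition. -/
def letterAct : State → Color → (Fin 3 → ℤ) → Fin 3 → ℤ
  | s, .black, a => addBox a s.row
  | s, .white, a => delBox a s.row

/-- `s` is the state string of the web `D`: with the colours of the boundary vertices of `D` it is
a dominant signature and state string, from which the growth rules build `D`. -/
def Web.HasStates {k : ℕ} {V : Type*} [Finite V] (D : Web k V) (s : Fin k → State) : Prop :=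
  IsDominant s (fun i => D.color (Sum.inl i)) ∧
    D.Grows (List.ofFn fun i => (Sum.inl i, s i)) Set.univ

/-- `T` is the generalized oscillating tableau that comes from the web `D`. -/
def GOT.ComesFrom {k : ℕ} {V : Type*} [Finite V] (T : GOT k 3) (D : Web k V) : Prop :=
  ∃ s : Fin k → State, D.HasStates s ∧
    ∀ i : Fin k, T.shape i.succ = letterAct (s i) (D.color (Sum.inl i)) (T.shape i.castSucc)

/-!
Suppose that `λ^1 = (1, 0, 0)`. By the local rules of promotion, `λ^s` arises from `μ^{s-1}` by
adding a box in a row `i_s`, and `i_1 ≤ … ≤ i_k`. Here `i_1 = 1` because `μ^0 = 0`, and `i_k = 3`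
because `λ^k` is constant and `μ^{k-1}` is a partition. Row `2` can only be skipped if
`λ^{s+1} = μ^{s-1}` is constant and `i_1 = … = i_s = 1`. In that case the signature and state string
is `x u y v`, where the letters `x` and `y` have opposite weights and `u` and `v` are closed
dominant words. The web growth rules preserve this shape until `u` is used up, and then only the arc
rule applies to `x` and `y`, so that `v_1` is joined to a boundary vertex.

The case `λ^1 = (0, 0, -1)` is dual: exchange the colours of the web and replace each shape
`(a_1, a_2, a_3)` by `(-a_3, -a_2, -a_1)`.
-/

/-! ### Rows of the promotion -/

section GrowthRule

variable {n : ℕ} {mu lam' nu : Fin n → ℤ} {i j : Fin n}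

theorem covBy_of_antitone_addBox_addBox (hmu : Antitone mu)
    (h : Antitone (addBox (addBox mu i) j)) (hj : ¬ Antitone (addBox mu j)) : i ⋖ j := by
  have eq_of_le : ∀ r < j, mu r ≤ mu j → r = i := by
    intro r hrj hle
    by_contra hri
    have := h hrj.le
    simp only [addBox, Pi.add_apply, Pi.single_apply, if_neg hri, if_neg hrj.ne] at this
    split_ifs at this <;> omega
  simp only [antitone_addBox_iff hmu, not_forall, not_lt] at hj
  obtain ⟨r, hrj, hle⟩ := hj
  obtain rfl := eq_of_le r hrj hle
  exact ⟨hrj, fun c hrc hcj => hrc.ne' (eq_of_le c hcj ((hmu hrc.le).trans hle))⟩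

theorem apply_eq_of_not_antitone_delBox (hmu : Antitone mu) (hij : i ≤ j)
    (h : ∀ q, i ≤ q → q < j → ¬ Antitone (delBox mu q)) : mu i = mu j := by
  refine le_antisymm ?_ (hmu hij)
  by_contra! hlt
  obtain ⟨q, hiq, hq, hmax⟩ :=
    (Set.toFinite {q | mu i ≤ mu q}).exists_le_maximal (show mu i ≤ mu i from le_rfl)
  have hqj : q < j := by
    by_contra! hjq
    exact hlt.not_ge (hq.trans (hmu hjq))
  refine h q hiq hqj ((antitone_delBox_iff hmu q).2 fun r hqr => ?_)
  by_contra! hle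
  exact hqr.not_ge (hmax (hq.trans hle) hqr.le)

/-- The second alternative is the rule that moves a box across several rows: there the two steps
from `mu` to `lam'` cancel. -/
theorem GrowthRule.exists_addBox (h : GrowthRule mu (addBox mu i) lam' nu) (hmu : Antitone mu)
    (hlam' : Antitone lam') :
    ∃ j, lam' = addBox nu j ∧ (i ⩿ j ∨ i < j ∧ lam' = mu ∧ mu i = mu j) := by
  cases h with
  | op1a i' j h1 h2 =>
    exact ⟨i, by rw [h2, addBox_addBox], .inl (WCovBy.refl i)⟩
  | op1b i' j h1 h2 _ h =>
    obtain rfl := addBox_eq_iff.1 h1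
    exact ⟨j, h2, .inl (covBy_of_antitone_addBox_addBox hmu (h2 ▸ hlam') h).wcovBy⟩
  | op1c i' j h1 h2 =>
    exact ⟨i, by rw [h2, addBox_delBox], .inl (WCovBy.refl i)⟩
  | op1d i' r h1 h2 h hr _ hmin =>
    obtain rfl := addBox_eq_iff.1 h1
    rw [delBox_addBox_self] at h2
    have hconst : mu i = mu r := apply_eq_of_not_antitone_delBox hmu hr.le fun q hiq hqr =>
      hiq.eq_or_lt.elim (fun hq => hq ▸ h) fun hq => hmin q hq hqr
    exact ⟨r, by rw [h2, addBox_delBox, delBox_addBox_self], .inr ⟨hr, h2, hconst⟩⟩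
  | op2a _ _ h1 | op2b _ _ h1 | op2c _ _ h1 | op2d _ _ h1 =>
    exact absurd h1 (addBox_ne_delBox _ _ _)

theorem isTop_of_addBox_const (hmu : Antitone mu) (h : ∀ r s, addBox mu i r = addBox mu i s) :
    IsTop i := by
  intro r
  by_contra! hir
  have hle := hmu hir.le
  have heq := h r i
  simp only [addBox, Pi.add_apply, Pi.single_apply, if_neg hir.ne', if_true] at heq
  omega

end GrowthRule

/-- `row s` is the row in which `λ^{s+1}` has one box more than the shape `μ^s` of the promotion:
the sequence `i_1, …, i_k` of the proposition, indexed from `0`. -/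
def GOT.IsPromotionRow {k n : ℕ} (T : GOT k n) (row : Fin k → Fin n) : Prop :=
  ∀ s, T.shape s.succ = addBox (T.promotion.shape s.castSucc) (row s)

section PromotionRow

variable {k n : ℕ}

theorem GOT.isPromotion_promotion (T : GOT k n) : IsPromotion T T.promotion :=
  T.existsUnique_isPromotion.choose_spec.1

theorem GOT.growthRule_promotion (T : GOT (k + 1) n) (s : Fin k) :
    GrowthRule (T.promotion.shape s.castSucc.castSucc) (T.shape s.castSucc.succ)
      (T.shape s.succ.succ) (T.promotion.shape s.succ.castSucc) :=
  T.isPromotion_promotion.rule s (by omega)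

theorem GOT.exists_isPromotionRow {T : GOT (k + 1) n} {i : Fin n} (h : T.shape 1 = addBox 0 i) :
    ∃ row, T.IsPromotionRow row := by
  suffices ∀ s : Fin (k + 1), ∃ i, T.shape s.succ = addBox (T.promotion.shape s.castSucc) i from
    Classical.skolem.1 this
  intro s
  induction s using Fin.induction with
  | zero => exact ⟨i, by rw [Fin.castSucc_zero, T.promotion.shape_zero, Fin.succ_zero_eq_one, h]⟩
  | succ s ih =>
    obtain ⟨i, hi⟩ := ih
    obtain ⟨j, hj, -⟩ := (hi ▸ T.growthRule_promotion s).exists_addBox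
      (T.promotion.isGenPartition _) (T.isGenPartition _)
    exact ⟨j, hj⟩

namespace GOT.IsPromotionRow

variable {T : GOT (k + 1) n} {row : Fin (k + 1) → Fin n}

theorem apply_zero (h : T.IsPromotionRow row) {i : Fin n} (h1 : T.shape 1 = addBox 0 i) :
    row 0 = i := by
  have h0 := h 0
  rw [Fin.succ_zero_eq_one, h1, Fin.castSucc_zero, T.promotion.shape_zero] at h0
  exact (addBox_eq_iff.1 h0).symm

theorem wcovBy_or (h : T.IsPromotionRow row) (s : Fin k) :
    row s.castSucc ⩿ row s.succ ∨
      row s.castSucc < row s.succ ∧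
        T.shape s.succ.succ = T.promotion.shape s.castSucc.castSucc ∧
        T.promotion.shape s.castSucc.castSucc (row s.castSucc) =
          T.promotion.shape s.castSucc.castSucc (row s.succ) := by
  obtain ⟨j, hj, hstep⟩ := (h s.castSucc ▸ T.growthRule_promotion s).exists_addBox
    (T.promotion.isGenPartition _) (T.isGenPartition _)
  obtain rfl : j = row s.succ := addBox_eq_iff.1 (hj.symm.trans (h s.succ))
  exact hstep

theorem monotone (h : T.IsPromotionRow row) : Monotone row :=
  Fin.monotone_iff_le_succ.2 fun s => (h.wcovBy_or s).elim WCovBy.le fun hs => hs.1.le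

theorem isTop_apply_last (h : T.IsPromotionRow row)
    (hlast : ∀ i j, T.shape (Fin.last (k + 1)) i = T.shape (Fin.last (k + 1)) j) :
    IsTop (row (Fin.last k)) := by
  rw [← Fin.succ_last, h] at hlast
  exact isTop_of_addBox_const (T.promotion.isGenPartition _) hlast

end GOT.IsPromotionRow

end PromotionRow

/-- A relation between the times `1, …, k` and the rows holds with row `a` during an initial phase,
then with row `b`, and finally with row `c`, each of the phases being nonempty. Time `s + 1` is
encoded as `s : Fin k`. -/
def InThreePhases {k : ℕ} (R : Fin k → Fin 3 → Prop) (a b c : Fin 3) : Prop :=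
  ∃ m n : ℕ, 1 ≤ m ∧ m + 1 < n ∧ n ≤ k ∧ ∀ s : Fin k,
    ((s : ℕ) + 1 ≤ m → R s a) ∧ (m < (s : ℕ) + 1 → (s : ℕ) + 1 < n → R s b) ∧
      (n ≤ (s : ℕ) + 1 → R s c)

theorem InThreePhases.imp {k : ℕ} {R R' : Fin k → Fin 3 → Prop} {a b c : Fin 3}
    (h : InThreePhases R a b c) (f : Fin 3 → Fin 3) (hf : ∀ s i, R s i → R' s (f i)) :
    InThreePhases R' (f a) (f b) (f c) := by
  obtain ⟨m, n, hm, hmn, hn, hR⟩ := h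
  exact ⟨m, n, hm, hmn, hn, fun s => ⟨fun h => hf _ _ ((hR s).1 h),
    fun h h' => hf _ _ ((hR s).2.1 h h'), fun h => hf _ _ ((hR s).2.2 h)⟩⟩

theorem exists_forall_iff_lt_of_antitone {k : ℕ} {p : Fin k → Prop} (hp : Antitone p) :
    ∃ m : ℕ, ∀ s : Fin k, p s ↔ (s : ℕ) < m := by
  classical
  have hex : ∃ m : ℕ, ∀ h : m < k, ¬ p ⟨m, h⟩ := ⟨k, fun h => absurd h (lt_irrefl k)⟩
  refine ⟨Nat.find hex, fun s => ⟨fun hs => ?_, fun hs => ?_⟩⟩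
  · by_contra! hle
    exact Nat.find_spec hex (hle.trans_lt s.2) (hp (Fin.le_def.2 hle) hs)
  · by_contra hps
    exact Nat.find_min hex hs fun _ => hps

theorem inThreePhases_of_monotone {k : ℕ} {row : Fin (k + 1) → Fin 3} (hmono : Monotone row)
    (hzero : row 0 = 0) (hlast : row (Fin.last k) = 2)
    (hskip : ∀ s : Fin k, row s.castSucc = 0 → row s.succ ≠ 2) :
    InThreePhases (fun s i => row s = i) 0 1 2 := by
  obtain ⟨m, hm⟩ := exists_forall_iff_lt_of_antitone (p := fun s => row s ≤ 0)
    fun _ _ hst ht => (hmono hst).trans ht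
  obtain ⟨n, hn⟩ := exists_forall_iff_lt_of_antitone (p := fun s => row s ≤ 1)
    fun _ _ hst ht => (hmono hst).trans ht
  have hm_pos : 0 < m := (hm 0).1 hzero.le
  have hm_le : m ≤ k := not_lt.1 fun h => absurd ((hm (Fin.last k)).2 h) (by simp [hlast])
  have hn_le : n ≤ k := not_lt.1 fun h => absurd ((hn (Fin.last k)).2 h) (by simp [hlast])
  have hmn : m < n := by
    obtain ⟨m, rfl⟩ := Nat.exists_eq_succ_of_ne_zero hm_pos.ne'
    have := hskip ⟨m, hm_le⟩ (by simpa using (hm (Fin.castSucc ⟨m, hm_le⟩)).2 m.lt_succ_self)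
    exact (hn (Fin.succ ⟨m, hm_le⟩)).1 (by omega)
  refine ⟨m, n + 1, hm_pos, by omega, by omega, fun s => ?_⟩
  have hms := hm s
  have hns := hn s
  exact ⟨by omega, by omega, by omega⟩

/-! ### Dominant words and the web growth rules -/

section Words

/-- A letter of a signature and state string. -/
abbrev Letter := State × Color

/-- The `sl(3)`-weight of a letter. -/
def Letter.weight (a : Letter) : ℤ × ℤ := letterWeight a.1 a.2

/-- The weight path of the word that starts at `p` stays in the dominant chamber and ends at the
origin. For `p = 0` these are the closed dominant words. -/
def IsDominantFrom : ℤ × ℤ → List Letter → Prop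
  | p, [] => p = 0
  | p, a :: w => 0 ≤ p ∧ IsDominantFrom (p + a.weight) w

theorem IsDominantFrom.nonneg {p : ℤ × ℤ} {w : List Letter} (h : IsDominantFrom p w) : 0 ≤ p := by
  cases w with
  | nil => exact (show p = 0 from h).ge
  | cons a w => exact h.1

theorem IsDominantFrom.weight_head_nonneg {a : Letter} {w : List Letter}
    (h : IsDominantFrom 0 (a :: w)) : 0 ≤ a.weight := by
  simpa only [zero_add] using h.2.nonneg

theorem IsDominantFrom.weight_last_nonpos {p : ℤ × ℤ} {w : List Letter} {a : Letter}
    (h : IsDominantFrom p (w ++ [a])) : a.weight ≤ 0 := by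
  induction w generalizing p with
  | nil => exact (le_add_of_nonneg_left h.1).trans_eq (show p + a.weight = 0 from h.2)
  | cons b w ih => exact ih h.2

theorem isDominantFrom_take_drop_ofFn {k : ℕ} {f : Fin k → Letter} {path : Fin (k + 1) → ℤ × ℤ}
    (hstep : ∀ i, path i.succ = path i.castSucc + (f i).weight) {p : ℤ × ℤ} {b c : ℕ}
    (hbc : b ≤ c) (hck : c < k + 1) (hle : ∀ i : Fin (k + 1), b ≤ i → (i : ℕ) < c → p ≤ path i)
    (hend : path ⟨c, hck⟩ = p) :
    IsDominantFrom (path ⟨b, by omega⟩ - p) (((List.ofFn f).drop b).take (c - b)) := by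
  induction hbc using Nat.decreasingInduction with
  | self => simpa [IsDominantFrom] using sub_eq_zero.2 hend
  | of_succ b hbc ih =>
    have hbk : b < k := by omega
    rw [List.drop_eq_getElem_cons (by simpa using hbk), List.getElem_ofFn,
      show c - b = c - (b + 1) + 1 by omega, List.take_succ_cons]
    refine ⟨sub_nonneg.2 (hle _ le_rfl hbc), ?_⟩
    have hnext : path ⟨b + 1, by omega⟩ = path ⟨b, by omega⟩ + (f ⟨b, hbk⟩).weight :=
      hstep ⟨b, hbk⟩
    have := ih fun i hi => hle i (by omega)
    rwa [hnext, add_sub_right_comm] at this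

/-- The effect of a growth rule on a word: neighbouring letters `a b` may be replaced by `m`
without leaving the dominant chamber, and neither can `a` end nor `b` begin a closed dominant
word. -/
structure IsReplaceable (a b : Letter) (m : List Letter) : Prop where
  not_nonpos_left : ¬ a.weight ≤ 0
  not_nonneg_right : ¬ 0 ≤ b.weight
  isDominantFrom_append : ∀ p w, IsDominantFrom p (a :: b :: w) → IsDominantFrom p (m ++ w)

theorem IsReplaceable.isDominantFrom {a b : Letter} {m : List Letter} (h : IsReplaceable a b m)
    {p : ℤ × ℤ} {l r : List Letter} (hd : IsDominantFrom p (l ++ a :: b :: r)) :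
    IsDominantFrom p (l ++ m ++ r) := by
  induction l generalizing p with
  | nil => exact h.isDominantFrom_append p r hd
  | cons c l ih => exact ⟨hd.1, ih hd.2⟩

theorem eq_append_cons_of_append_cons_cons_eq {α : Type*} {l r w v : List α} {a b y : α}
    (h : l ++ a :: b :: r = w ++ y :: v) :
    (∃ r', w = l ++ a :: b :: r' ∧ r = r' ++ y :: v) ∨ (w = l ++ [a] ∧ b = y ∧ r = v) ∨
      (a = y ∧ w = l) ∨ ∃ l', l = w ++ y :: l' ∧ v = l' ++ a :: b :: r := by
  obtain ⟨_ | ⟨c, _ | ⟨d, t⟩⟩, rfl, ht⟩ | ⟨_ | ⟨c, t⟩, rfl, ht⟩ := List.append_eq_append_iff.1 h <;>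
    simp_all

/-- A replaceable pair in `x u y v` is `x y` itself, or lies inside `u` or inside `v`. -/
theorem IsReplaceable.eq_or_exists {α : Type*} {f : α → Letter} {l r u v m : List α} {a b x y : α}
    (h : IsReplaceable (f a) (f b) (m.map f)) (hy : (f y).weight ≤ 0)
    (hu : IsDominantFrom 0 (u.map f)) (hv : IsDominantFrom 0 (v.map f))
    (heq : l ++ a :: b :: r = x :: u ++ y :: v) :
    (a = x ∧ b = y) ∨ ∃ u' v', IsDominantFrom 0 (u'.map f) ∧ IsDominantFrom 0 (v'.map f) ∧
      l ++ m ++ r = x :: u' ++ y :: v' := by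
  obtain ⟨r', hxu, rfl⟩ | ⟨hxu, rfl, rfl⟩ | ⟨rfl, -⟩ | ⟨l', rfl, rfl⟩ :=
    eq_append_cons_of_append_cons_cons_eq heq
  · obtain ⟨-, h'⟩ | ⟨l', rfl, rfl⟩ := List.cons_eq_append_iff.1 hxu
    · obtain ⟨-, rfl⟩ := List.cons.inj h'
      exact absurd hu.weight_head_nonneg h.not_nonneg_right
    · refine .inr ⟨l' ++ m ++ r', v, ?_, hv, by simp⟩
      simp only [List.map_append, List.map_cons] at hu ⊢
      exact h.isDominantFrom hu
  · obtain ⟨-, h'⟩ | ⟨l', rfl, rfl⟩ := List.cons_eq_append_iff.1 hxu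
    · exact .inl ⟨(List.cons.inj h').1, rfl⟩
    · rw [List.map_append] at hu
      exact absurd hu.weight_last_nonpos h.not_nonpos_left
  · exact absurd hy h.not_nonpos_left
  · refine .inr ⟨u, l' ++ m ++ r, hu, ?_, by simp⟩
    simp only [List.map_append, List.map_cons] at hv ⊢
    exact h.isDominantFrom hv

end Words

/-- The opposite colour. -/
def Color.dual : Color → Color
  | .black => .white
  | .white => .black

theorem Color.dual_dual (c : Color) : c.dual.dual = c := by cases c <;> rfl

theorem Color.ne_iff_eq_dual {c c' : Color} : c' ≠ c ↔ c' = c.dual := by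
  cases c <;> cases c' <;> simp [Color.dual]

section Rules

variable {c : Color} {s s₁ s₂ t t₁ t₂ : State}

theorem YRule.isReplaceable (h : YRule c s₁ s₂ t) :
    IsReplaceable (s₁, c) (s₂, c) [(t, c.dual)] where
  not_nonpos_left := by cases h <;> decide
  not_nonneg_right := by cases h <;> decide
  isDominantFrom_append p w hw := by
    have hweight : Letter.weight (t, c.dual) = Letter.weight (s₁, c) + Letter.weight (s₂, c) := by
      cases h <;> rfl
    obtain ⟨hp, -, hw⟩ := hw
    refine ⟨hp, ?_⟩
    rwa [hweight, ← add_assoc]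

theorem YRule.weight_add_weight_ne_zero (h : YRule c s₁ s₂ t) :
    Letter.weight (s₁, c) + Letter.weight (s₂, c) ≠ 0 := by
  cases h <;> decide

theorem HRule.isReplaceable (h : HRule c s₁ s₂ t₁ t₂) :
    IsReplaceable (s₁, c) (s₂, c.dual) [(t₁, c.dual), (t₂, c)] where
  not_nonpos_left := by cases h <;> decide
  not_nonneg_right := by cases h <;> decide
  isDominantFrom_append p w hw := by
    have hweight : Letter.weight (t₁, c.dual) + Letter.weight (t₂, c) =
        Letter.weight (s₁, c) + Letter.weight (s₂, c.dual) := by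
      cases h <;> rfl
    obtain ⟨hp, hp₁, hw⟩ := hw
    have hp₂ := hw.nonneg
    refine ⟨hp, ?_, ?_⟩
    · obtain ⟨x, y⟩ := p
      cases h <;>
        simp_all [Letter.weight, letterWeight, State.weight, Color.dual, Prod.le_def]
    · rwa [add_assoc, hweight, ← add_assoc]

theorem HRule.weight_add_weight_ne_zero (h : HRule c s₁ s₂ t₁ t₂)
    (h₁ : 0 ≤ Letter.weight (s₁, c)) :
    Letter.weight (s₁, c) + Letter.weight (s₂, c.dual) ≠ 0 := by
  revert h₁
  cases h <;> decide

theorem ArcRule.isReplaceable (h : ArcRule c s) : IsReplaceable (s, c) (s, c.dual) [] where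
  not_nonpos_left := by cases h <;> decide
  not_nonneg_right := by cases h <;> decide
  isDominantFrom_append p w hw := by
    have hweight : Letter.weight (s, c) + Letter.weight (s, c.dual) = 0 := by cases h <;> rfl
    simpa only [add_assoc, hweight, add_zero, List.nil_append] using hw.2.2

end Rules

section Web

variable {k : ℕ} {V : Type*} [Finite V]

theorem Web.color_vertex_of_edge_eq (D : Web k V) {d d' : Dart k V} (h : D.edge d = d') :
    D.color d'.vertex = (D.color d.vertex).dual :=
  Color.ne_iff_eq_dual.1 (h ▸ D.bipartite d)

/-- The letter of a labelled strand. -/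
def Web.letter (D : Web k V) (x : Dart k V × State) : Letter :=
  (x.2, D.color x.1.vertex)

/-- The shape `x u y v` of the word of strands persists until `u` is used up, and then only the arc
rule applies to `x` and `y`. -/
theorem Web.Grows.edge_eq {D : Web k V} {L : List (Dart k V × State)} {U : Set V}
    (h : D.Grows L U) {x y : Dart k V × State} (hx : 0 ≤ (D.letter x).weight)
    (hxy : (D.letter x).weight + (D.letter y).weight = 0) {u v : List (Dart k V × State)}
    (hu : IsDominantFrom 0 (u.map D.letter)) (hv : IsDominantFrom 0 (v.map D.letter))
    (hL : L = x :: u ++ y :: v) : D.edge x.1 = y.1 := by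
  have hy : (D.letter y).weight ≤ 0 := hxy ▸ le_add_of_nonneg_left hx
  induction h generalizing u v with
  | done => simp at hL
  | fork l r _ d₁ d₂ s₁ s₂ t w a hc hrule h₁ _ _ _ ih =>
    have hd₁ := D.color_vertex_of_edge_eq h₁
    have hrep : IsReplaceable (D.letter (d₁, s₁)) (D.letter (d₂, s₂))
        ([(Sum.inr (w, a + 2), t)].map D.letter) := by
      change IsReplaceable (s₁, _) (s₂, D.color d₂.vertex) [(t, D.color (Sum.inr w))]
      rw [hc, show D.color (Sum.inr w) = _ from hd₁]
      exact hrule.isReplaceable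
    obtain ⟨rfl, rfl⟩ | ⟨u', v', hu', hv', hL'⟩ := hrep.eq_or_exists hy hu hv hL
    · simp only [Web.letter, hc] at hxy
      exact absurd hxy hrule.weight_add_weight_ne_zero
    · exact ih hu' hv' (by simpa using hL')
  | cross l r _ d₁ d₂ s₁ s₂ t₁ t₂ w z a b hc hrule h₁ h₂ _ _ _ _ _ ih =>
    rw [Color.ne_iff_eq_dual] at hc
    have hd₁ := D.color_vertex_of_edge_eq h₁
    have hd₂ := D.color_vertex_of_edge_eq h₂
    have hrep : IsReplaceable (D.letter (d₁, s₁)) (D.letter (d₂, s₂))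
        ([(Sum.inr (w, a + 2), t₁), (Sum.inr (z, b + 1), t₂)].map D.letter) := by
      change IsReplaceable (s₁, _) (s₂, D.color d₂.vertex)
        [(t₁, D.color (Sum.inr w)), (t₂, D.color (Sum.inr z))]
      rw [show D.color (Sum.inr w) = _ from hd₁, show D.color (Sum.inr z) = _ from hd₂, hc,
        Color.dual_dual]
      exact hrule.isReplaceable
    obtain ⟨rfl, rfl⟩ | ⟨u', v', hu', hv', hL'⟩ := hrep.eq_or_exists hy hu hv hL
    · simp only [Web.letter, hc] at hxy
      exact absurd hxy (hrule.weight_add_weight_ne_zero hx)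
    · exact ih hu' hv' (by simpa using hL')
  | arc l r _ d₁ d₂ s hc hrule h₁ _ ih =>
    have hrep : IsReplaceable (D.letter (d₁, s)) (D.letter (d₂, s)) ([].map D.letter) := by
      rw [Color.ne_iff_eq_dual] at hc
      simpa only [Web.letter, hc, List.map_nil] using hrule.isReplaceable
    obtain ⟨rfl, rfl⟩ | ⟨u', v', hu', hv', hL'⟩ := hrep.eq_or_exists hy hu hv hL
    · exact h₁
    · exact ih hu' hv' (by simpa using hL')

theorem Web.Grows.edge_zero_eq {D : Web (k + 1) V} {st : Fin (k + 1) → State} {U : Set V}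
    (h : D.Grows (List.ofFn fun i => (Sum.inl i, st i)) U) {path : Fin (k + 2) → ℤ × ℤ}
    (hstep : ∀ i, path i.succ = path i.castSucc + letterWeight (st i) (D.color (Sum.inl i)))
    (hzero : path 0 = 0) (hnonneg : ∀ i, 0 ≤ path i) (hlast : path (Fin.last (k + 1)) = 0)
    {j : Fin k} (hle : ∀ i : Fin (k + 1), i < j.succ → path 1 ≤ path i.succ)
    (hreturn : path j.castSucc.succ = path 1) (hclose : path j.succ.succ = 0) :
    D.edge (Sum.inl 0) = Sum.inl j.succ := by
  set g : Fin k → Dart (k + 1) V × State := fun i => (Sum.inl i.succ, st i.succ)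
  have hstep' : ∀ i, path i.succ.succ = path i.castSucc.succ + (D.letter (g i)).weight :=
    fun i => hstep i.succ
  have hx : (D.letter (Sum.inl 0, st 0)).weight = path 1 := by
    have := hstep 0
    rw [Fin.castSucc_zero, hzero, zero_add] at this
    exact this.symm
  have hy : path 1 + (D.letter (g j)).weight = 0 := by rw [← hclose, hstep', hreturn]
  have hu : IsDominantFrom 0 (((List.ofFn g).take j).map D.letter) := by
    have := isDominantFrom_take_drop_ofFn (path := fun i => path i.succ) hstep' (p := path 1)
      (Nat.zero_le j) (by omega) (fun i _ hi => hle i (Fin.lt_def.2 (by simp; omega))) hreturn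
    simpa [List.map_ofFn, Function.comp_def] using this
  have hv : IsDominantFrom 0 (((List.ofFn g).drop (j + 1)).map D.letter) := by
    have := isDominantFrom_take_drop_ofFn (path := fun i => path i.succ) hstep' (p := 0)
      (b := j + 1) (c := k) (by omega) (by omega) (fun i _ _ => hnonneg _) hlast
    rw [show path (Fin.succ ⟨j + 1, _⟩) = 0 from hclose, sub_zero,
      List.take_of_length_le (by simp)] at this
    simpa [List.map_drop, List.map_ofFn, Function.comp_def] using this
  refine h.edge_eq (x := (Sum.inl 0, st 0)) (y := g j) (hx ▸ hnonneg 1) (hx ▸ hy) hu hv ?_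
  rw [List.ofFn_succ, List.cons_append]
  congr 1
  have hdrop := List.drop_eq_getElem_cons (l := List.ofFn g) (i := j) (by simp)
  rw [List.getElem_ofFn] at hdrop
  rw [← hdrop, List.take_append_drop]

end Web

section ShapeWeight

/-- The `sl(3)`-weight of a sequence of three row sizes, in the basis of `letterWeight`. -/
def shapeWeight (a : Fin 3 → ℤ) : ℤ × ℤ := (a 0 - a 1, a 1 - a 2)

theorem shapeWeight_zero : shapeWeight 0 = 0 := rfl

theorem shapeWeight_nonneg {a : Fin 3 → ℤ} (h : Antitone a) : 0 ≤ shapeWeight a :=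
  ⟨sub_nonneg.2 (h (by decide)), sub_nonneg.2 (h (by decide))⟩

theorem shapeWeight_letterAct (s : State) (c : Color) (a : Fin 3 → ℤ) :
    shapeWeight (letterAct s c a) = shapeWeight a + letterWeight s c := by
  cases s <;> cases c <;> ext <;>
    simp [shapeWeight, letterAct, letterWeight, State.row, State.weight, addBox, delBox] <;>
    ring

theorem shapeWeight_addBox_zero (a : Fin 3 → ℤ) :
    shapeWeight (addBox a 0) = shapeWeight a + (1, 0) :=
  shapeWeight_letterAct .one .black a

theorem shapeWeight_eq_zero_of_antitone {a : Fin 3 → ℤ} (ha : Antitone a) (h : a 0 = a 2) :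
    shapeWeight a = 0 := by
  have h01 : a 1 ≤ a 0 := ha (by decide)
  have h12 : a 2 ≤ a 1 := ha (by decide)
  ext <;> simp only [shapeWeight, Prod.fst_zero, Prod.snd_zero] <;> omega

theorem apply_eq_apply_of_shapeWeight_eq_zero {a : Fin 3 → ℤ} (h : shapeWeight a = 0)
    (i j : Fin 3) : a i = a j := by
  obtain ⟨h01, h12⟩ := Prod.ext_iff.1 h
  simp only [shapeWeight, Prod.fst_zero, Prod.snd_zero] at h01 h12
  fin_cases i <;> fin_cases j <;> simp <;> omega

end ShapeWeight

section ComesFrom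

variable {k : ℕ} {V : Type*} [Finite V] {D : Web k V} {T : GOT k 3}

theorem GOT.ComesFrom.exists_grows (hT : T.ComesFrom D) :
    ∃ st : Fin k → State, D.Grows (List.ofFn fun i => (Sum.inl i, st i)) Set.univ ∧
      ∀ i, shapeWeight (T.shape i.succ) =
        shapeWeight (T.shape i.castSucc) + letterWeight (st i) (D.color (Sum.inl i)) := by
  obtain ⟨st, ⟨-, hgrows⟩, hact⟩ := hT
  exact ⟨st, hgrows, fun i => by rw [hact, shapeWeight_letterAct]⟩

theorem GOT.ComesFrom.shapeWeight_last (hT : T.ComesFrom D) :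
    shapeWeight (T.shape (Fin.last k)) = 0 := by
  obtain ⟨st, ⟨⟨path, hzero, hlast, hstep, -⟩, -⟩, hact⟩ := hT
  have hpath : ∀ i, path i = shapeWeight (T.shape i) := by
    intro i
    induction i using Fin.induction with
    | zero => rw [hzero, T.shape_zero, shapeWeight_zero]
    | succ i ih => rw [hstep, ih, hact, shapeWeight_letterAct]
  rw [← hpath, hlast]

end ComesFrom

/-! ### Duality -/

section DualShape

variable {n : ℕ}

/-- The dual `(-a_n, …, -a_1)` of a generalized partition `a`. Duality exchanges adding and
deleting of boxes. -/
def dualShape (a : Fin n → ℤ) : Fin n → ℤ := fun i => -a i.rev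

theorem dualShape_dualShape (a : Fin n → ℤ) : dualShape (dualShape a) = a := by
  funext i
  simp [dualShape]

theorem dualShape_addBox (a : Fin n → ℤ) (i : Fin n) :
    dualShape (addBox a i) = delBox (dualShape a) i.rev := by
  funext j
  simp only [dualShape, addBox, delBox, Pi.add_apply, Pi.sub_apply, Pi.single_apply,
    Fin.rev_eq_iff]
  ring

theorem dualShape_delBox (a : Fin n → ℤ) (i : Fin n) :
    dualShape (delBox a i) = addBox (dualShape a) i.rev := by
  rw [← dualShape_dualShape (addBox _ _), dualShape_addBox, dualShape_dualShape, Fin.rev_rev]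

theorem antitone_dualShape {a : Fin n → ℤ} (h : Antitone a) : Antitone (dualShape a) :=
  fun _ _ hij => neg_le_neg (h (Fin.rev_le_rev.2 hij))

theorem antitone_dualShape_iff {a : Fin n → ℤ} : Antitone (dualShape a) ↔ Antitone a :=
  ⟨fun h => dualShape_dualShape a ▸ antitone_dualShape h, antitone_dualShape⟩

theorem antitone_addBox_dualShape_iff {a : Fin n → ℤ} {i : Fin n} :
    Antitone (addBox (dualShape a) i.rev) ↔ Antitone (delBox a i) := by
  rw [← dualShape_delBox, antitone_dualShape_iff]

theorem antitone_delBox_dualShape_iff {a : Fin n → ℤ} {i : Fin n} :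
    Antitone (delBox (dualShape a) i.rev) ↔ Antitone (addBox a i) := by
  rw [← dualShape_addBox, antitone_dualShape_iff]

theorem GrowthRule.dual {mu lam lam' nu : Fin n → ℤ} (h : GrowthRule mu lam lam' nu) :
    GrowthRule (dualShape mu) (dualShape lam) (dualShape lam') (dualShape nu) := by
  cases h with
  | op1a i j h1 h2 h =>
    subst h1 h2
    simp only [dualShape_addBox]
    exact .op2a _ _ rfl rfl (antitone_delBox_dualShape_iff.2 h)
  | op1b i j h1 h2 hij h =>
    subst h1 h2
    simp only [dualShape_addBox]
    exact .op2b _ _ rfl rfl (Fin.rev_injective.ne hij) (mt antitone_delBox_dualShape_iff.1 h)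
  | op1c i j h1 h2 h =>
    subst h1 h2
    simp only [dualShape_addBox, dualShape_delBox]
    exact .op2c _ _ rfl rfl (antitone_addBox_dualShape_iff.2 h)
  | op1d i r h1 h2 h hr hr' hmin =>
    subst h1 h2
    simp only [dualShape_addBox, dualShape_delBox]
    refine .op2d _ _ rfl rfl (mt antitone_addBox_dualShape_iff.1 h) (Fin.rev_lt_rev.2 hr)
      (antitone_addBox_dualShape_iff.2 hr') fun q hq hq' => ?_
    rw [← Fin.rev_rev q, antitone_addBox_dualShape_iff]
    exact hmin _ (Fin.lt_rev_iff.2 hq') (Fin.rev_lt_iff.2 hq)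
  | op2a i j h1 h2 h =>
    subst h1 h2
    simp only [dualShape_delBox]
    exact .op1a _ _ rfl rfl (antitone_addBox_dualShape_iff.2 h)
  | op2b i j h1 h2 hij h =>
    subst h1 h2
    simp only [dualShape_delBox]
    exact .op1b _ _ rfl rfl (Fin.rev_injective.ne hij) (mt antitone_addBox_dualShape_iff.1 h)
  | op2c i j h1 h2 h =>
    subst h1 h2
    simp only [dualShape_addBox, dualShape_delBox]
    exact .op1c _ _ rfl rfl (antitone_delBox_dualShape_iff.2 h)
  | op2d i r h1 h2 h hr hr' hmin =>
    subst h1 h2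
    simp only [dualShape_addBox, dualShape_delBox]
    refine .op1d _ _ rfl rfl (mt antitone_delBox_dualShape_iff.1 h) (Fin.rev_lt_rev.2 hr)
      (antitone_delBox_dualShape_iff.2 hr') fun q hq hq' => ?_
    rw [← Fin.rev_rev q, antitone_delBox_dualShape_iff]
    exact hmin _ (Fin.lt_rev_iff.2 hq') (Fin.rev_lt_iff.2 hq)

end DualShape

section GOTDual

variable {k n : ℕ}

/-- The tableau of the dual shapes. -/
def GOT.dual (T : GOT k n) : GOT k n where
  shape s := dualShape (T.shape s)
  isGenPartition s := antitone_dualShape (T.isGenPartition s)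
  shape_zero := by
    rw [T.shape_zero]
    exact funext fun _ => neg_zero
  oneBox s := by
    obtain ⟨i, h | h⟩ := T.oneBox s
    · exact ⟨i.rev, .inr (by rw [h, dualShape_addBox])⟩
    · exact ⟨i.rev, .inl (by rw [h, dualShape_delBox])⟩

theorem IsPromotion.dual {T P : GOT k n} (h : IsPromotion T P) : IsPromotion T.dual P.dual where
  rule s hs := (h.rule s hs).dual
  last := congrArg dualShape h.last

theorem GOT.promotion_dual (T : GOT k n) : T.dual.promotion = T.promotion.dual :=
  T.dual.existsUnique_isPromotion.unique T.dual.isPromotion_promotion T.isPromotion_promotion.dual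

end GOTDual

section WebDual

/-- The state with the opposite weight, up to exchanging the two fundamental weights. -/
def State.dual : State → State
  | .one => .negOne
  | .zero => .zero
  | .negOne => .one

theorem letterWeight_dual (s : State) (c : Color) :
    letterWeight s.dual c.dual = (letterWeight s c).swap := by
  cases s <;> cases c <;> rfl

theorem letterAct_dual (s : State) (c : Color) (a : Fin 3 → ℤ) :
    letterAct s.dual c.dual (dualShape a) = dualShape (letterAct s c a) := by
  cases s <;> cases c <;> simp only [letterAct, Color.dual, dualShape_addBox, dualShape_delBox] <;>
    rfl

theorem IsDominant.dual {k : ℕ} {s : Fin k → State} {c : Fin k → Color} (h : IsDominant s c) :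
    IsDominant (fun i => (s i).dual) fun i => (c i).dual := by
  obtain ⟨path, hzero, hlast, hstep, hnonneg⟩ := h
  refine ⟨fun i => (path i).swap, congrArg Prod.swap hzero, congrArg Prod.swap hlast, fun i => ?_,
    fun i => ⟨(hnonneg i).2, (hnonneg i).1⟩⟩
  simp only [hstep, letterWeight_dual, Prod.swap_add]

theorem YRule.dual {c : Color} {s₁ s₂ t : State} (h : YRule c s₁ s₂ t) :
    YRule c.dual s₁.dual s₂.dual t.dual := by
  cases h <;> constructor

theorem HRule.dual {c : Color} {s₁ s₂ t₁ t₂ : State} (h : HRule c s₁ s₂ t₁ t₂) :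
    HRule c.dual s₁.dual s₂.dual t₁.dual t₂.dual := by
  cases h <;> constructor

theorem ArcRule.dual {c : Color} {s : State} (h : ArcRule c s) : ArcRule c.dual s.dual := by
  cases h <;> constructor

theorem Color.dual_injective : Function.Injective Color.dual :=
  Function.LeftInverse.injective Color.dual_dual

variable {k : ℕ} {V : Type*} [Finite V]

/-- The web with the colours exchanged. -/
def Web.dual (D : Web k V) : Web k V :=
  { D with
    color := fun v => (D.color v).dual
    bipartite := fun d => Color.dual_injective.ne (D.bipartite d) }

theorem Web.Grows.dual {D : Web k V} {L : List (Dart k V × State)} {U : Set V}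
    (h : D.Grows L U) : D.dual.Grows (L.map (Prod.map id State.dual)) U := by
  induction h with
  | done => exact .done
  | fork l r U d₁ d₂ s₁ s₂ t v a hc hrule h₁ h₂ hv _ ih =>
    simp only [List.map_append, List.map_cons, Prod.map_apply, id] at ih ⊢
    exact .fork _ _ _ _ _ _ _ _ _ _ (congrArg Color.dual hc) hrule.dual h₁ h₂ hv ih
  | cross l r U d₁ d₂ s₁ s₂ t₁ t₂ v w a b hc hrule h₁ h₂ hmid hvw hv hw _ ih =>
    simp only [List.map_append, List.map_cons, Prod.map_apply, id] at ih ⊢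
    exact .cross _ _ _ _ _ _ _ _ _ _ _ _ _ (Color.dual_injective.ne hc) hrule.dual h₁ h₂ hmid
      hvw hv hw ih
  | arc l r U d₁ d₂ s hc hrule h₁ _ ih =>
    simp only [List.map_append, List.map_cons, Prod.map_apply, id] at ih ⊢
    exact .arc _ _ _ _ _ _ (Color.dual_injective.ne hc) hrule.dual h₁ ih

theorem GOT.ComesFrom.dual {D : Web k V} {T : GOT k 3} (hT : T.ComesFrom D) :
    T.dual.ComesFrom D.dual := by
  obtain ⟨st, ⟨hdom, hgrows⟩, hact⟩ := hT
  refine ⟨fun i => (st i).dual, ⟨hdom.dual, ?_⟩, fun i => ?_⟩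
  · have := hgrows.dual
    rwa [List.map_ofFn] at this
  · exact (congrArg dualShape (hact i)).trans (letterAct_dual _ _ _).symm

end WebDual

section MainTheorem

variable {k : ℕ} {V : Type*} [Finite V]

/-- Skipping row `2` forces `λ^{s+1} = μ^{s-1}` to be constant, while `i_1 = … = i_s = 1`. -/
theorem GOT.IsPromotionRow.edge_zero_eq_of_skip {D : Web (k + 1) V} {T : GOT (k + 1) 3}
    (hT : T.ComesFrom D) {row : Fin (k + 1) → Fin 3} (h : T.IsPromotionRow row)
    {s : Fin k} (hs : row s.castSucc = 0) (hs' : row s.succ = 2) :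
    D.edge (Sum.inl 0) = Sum.inl s.succ := by
  set P := T.promotion
  obtain ⟨hreturn, hconst⟩ : T.shape s.succ.succ = P.shape s.castSucc.castSucc ∧
      P.shape s.castSucc.castSucc 0 = P.shape s.castSucc.castSucc 2 := by
    have hstep := h.wcovBy_or s
    simp only [hs, hs'] at hstep
    exact (hstep.resolve_left (by simp [wcovBy_iff_covBy_or_eq, Fin.covBy_iff])).2
  have hweight : shapeWeight (P.shape s.castSucc.castSucc) = 0 :=
    shapeWeight_eq_zero_of_antitone (P.isGenPartition _) hconst
  have hpath : ∀ r ≤ s.castSucc,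
      shapeWeight (T.shape r.succ) = shapeWeight (P.shape r.castSucc) + (1, 0) := by
    intro r hr
    have hr' : row r = 0 := Fin.le_zero_iff.1 ((h.monotone hr).trans_eq hs)
    rw [h r, hr', shapeWeight_addBox_zero]
  have hone : shapeWeight (T.shape 1) = (1, 0) := by
    simpa [P.shape_zero, shapeWeight_zero] using hpath 0 (Fin.zero_le _)
  obtain ⟨st, hgrows, hstep⟩ := hT.exists_grows
  refine hgrows.edge_zero_eq (path := fun i => shapeWeight (T.shape i)) hstep ?_
    (fun i => shapeWeight_nonneg (T.isGenPartition i)) hT.shapeWeight_last (fun r hr => ?_) ?_ ?_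
  · rw [T.shape_zero, shapeWeight_zero]
  · rw [hone, hpath r (Fin.le_castSucc_iff.2 hr)]
    exact le_add_of_nonneg_left (shapeWeight_nonneg (P.isGenPartition _))
  · rw [hpath _ le_rfl, hweight, hone, zero_add]
  · rw [hreturn, hweight]

variable {D : Web k V} {T : GOT k 3}

theorem GOT.ComesFrom.inThreePhases_addBox (hT : T.ComesFrom D)
    (hD : ∀ i j : Fin k, (i : ℕ) = 0 → D.edge (Sum.inl i) ≠ Sum.inl j)
    (h1 : T.shape 1 = addBox 0 0) :
    InThreePhases (fun s i => T.shape s.succ = addBox (T.promotion.shape s.castSucc) i) 0 1 2 := by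
  cases k with
  | zero =>
    have := congrFun (T.shape_zero.symm.trans h1) 0
    simp [addBox] at this
  | succ k =>
    obtain ⟨row, hrow⟩ := GOT.exists_isPromotionRow h1
    have hlast : row (Fin.last k) = 2 := (Fin.last_le_iff (n := 2)).1 <|
      hrow.isTop_apply_last (apply_eq_apply_of_shapeWeight_eq_zero hT.shapeWeight_last) _
    have hskip : ∀ s : Fin k, row s.castSucc = 0 → row s.succ ≠ 2 := fun s hs hs' =>
      hD 0 s.succ rfl (hrow.edge_zero_eq_of_skip hT hs hs')
    exact (inThreePhases_of_monotone hrow.monotone (hrow.apply_zero h1) hlast hskip).imp id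
      fun s i hi => hi ▸ hrow s

theorem GOT.ComesFrom.inThreePhases_delBox (hT : T.ComesFrom D)
    (hD : ∀ i j : Fin k, (i : ℕ) = 0 → D.edge (Sum.inl i) ≠ Sum.inl j)
    (h1 : T.shape 1 = delBox 0 2) :
    InThreePhases (fun s i => T.shape s.succ = delBox (T.promotion.shape s.castSucc) i) 2 1 0 := by
  have h1' : T.dual.shape 1 = addBox 0 0 := by
    rw [← T.dual.shape_zero]
    exact (congrArg dualShape h1).trans (by rw [dualShape_delBox, ← T.shape_zero]; rfl)
  refine (hT.dual.inThreePhases_addBox hD h1').imp Fin.rev fun s i hi => ?_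
  rw [T.promotion_dual] at hi
  simpa only [GOT.dual, dualShape_addBox, dualShape_dualShape] using congrArg dualShape hi

theorem mainTheorem5_general (hT : T.ComesFrom D)
    (hD : ∀ i j : Fin k, (i : ℕ) = 0 → D.edge (Sum.inl i) ≠ Sum.inl j) :
    (T.shape 1 = ![1, 0, 0] →
      InThreePhases (fun s i => T.shape s.succ = addBox (T.promotion.shape s.castSucc) i) 0 1 2) ∧
    (T.shape 1 = ![0, 0, -1] →
      InThreePhases (fun s i => T.shape s.succ = delBox (T.promotion.shape s.castSucc) i) 2 1 0) :=
  ⟨fun h1 => hT.inThreePhases_addBox hD (h1.trans (by decide)),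
    fun h1 => hT.inThreePhases_delBox hD (h1.trans (by decide))⟩

end MainTheorem

theorem mainTheorem5 {k : ℕ} {V : Type*} [Finite V] (D : Web k V) (hD : ¬ D.ContainsIdentity)
    (T : GOT k 3) (hT : T.ComesFrom D) :
    (T.shape 1 = ![1, 0, 0] →
      ∃ m n : ℕ, 1 ≤ m ∧ m + 1 < n ∧ n ≤ k ∧ ∀ s : Fin k,
        ((s : ℕ) + 1 ≤ m → T.shape s.succ = addBox (T.promotion.shape s.castSucc) 0) ∧
        (m < (s : ℕ) + 1 → (s : ℕ) + 1 < n →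
          T.shape s.succ = addBox (T.promotion.shape s.castSucc) 1) ∧
        (n ≤ (s : ℕ) + 1 → T.shape s.succ = addBox (T.promotion.shape s.castSucc) 2)) ∧
    (T.shape 1 = ![0, 0, -1] →
      ∃ m n : ℕ, 1 ≤ m ∧ m + 1 < n ∧ n ≤ k ∧ ∀ s : Fin k,
        ((s : ℕ) + 1 ≤ m → T.shape s.succ = delBox (T.promotion.shape s.castSucc) 2) ∧
        (m < (s : ℕ) + 1 → (s : ℕ) + 1 < n →
          T.shape s.succ = delBox (T.promotion.shape s.castSucc) 1) ∧
        (n ≤ (s : ℕ) + 1 → T.shape s.succ = delBox (T.promotion.shape s.castSucc) 0)) :=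
  mainTheorem5_general hT fun i j _ h => hD ⟨i, j, h⟩
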